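/- A staircase tableau of size $n\ge 0$ is a Ferrers diagram of shape $(n,n-1,\dots,2,1)$ (rows listed from top to bottom, left-justified) in which each box is either empty or labeled with $\alpha,\beta,\gamma$ or $\delta$, such that no box on the diagonal (the last boxes of the rows) is empty, all boxes in the same row and to the left of a $\beta$ or $\delta$ are empty, and all boxes in the same column and above an $\alpha$ or $\gamma$ are empty. A blank box receives a $q$ if the closest labeled box to its right in its row is a $\delta$, or if that box is an $\alpha$ or $\gamma$ and the closest labeled box below it in its column is a $\beta$ or $\gamma$; every other blank box receives a $1$. The weight $\mathbf w(\mathcal T)$ of a staircase tableau $\mathcal T$ is the product of the entries of all its boxes, $t(\mathcal T)$ is the number of diagonal boxes labeled $\alpha$ or $\delta$, and $$Z_n(y;\alpha,\beta,\gamma,\delta;q)=\sum_{\mathcal T\text{ of size }n}\mathbf w(\mathcal T)\,y^{t(\mathcal T)}.$$ For $n\ge0$ and $k\in\mathbb Z$ let $T(n,k)$ be the number of staircase tableaux $\mathcal T$ of size $n$ without any label $\gamma$ and with $t(\mathcal T)=k$. Then, for all $n\ge 1$ and $k\in\mathbb Z$, $$T(n,k)=(k+1)\,T(n-1,k)+(n+1)\,T(n-1,k-1)+(n-k+1)\,T(n-1,k-2).$$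 Moreover, for every $n\ge0$, all complex roots of the polynomial $Z_n(y;1,1,0,1;1)$ are real and lie in the open interval $]-1,0[$. As a consequence, this polynomial is stable (it has no zero in the open upper half-plane, and also no zero with nonnegative real part), and it is log-concave: its coefficients $a_0,a_1,a_2,\dots$ are nonnegative and satisfy $a_k\,a_{k+2}\le a_{k+1}^2$ for all $k\ge0$. -/

import Mathlib

open Polynomial

/-- The four possible labels of a box. -/
inductive Label
  | alpha | beta | gamma | delta
  deriving DecidableEq

instance : Fintype Label :=
  ⟨{Label.alpha, Label.beta, Label.gamma, Label.delta}, by intro x; cases x <;> simp⟩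

/-- The boxes of the Ferrers diagram of shape `(n, n - 1, …, 2, 1)`, as pairs (row, column).
Rows are numbered `0, …, n - 1` from top to bottom and columns `0, …, n - 1` from left to right;
row `i` consists of the `n - i` boxes `(i, j)` with `i + j < n`. -/
abbrev Box (n : ℕ) : Type := {p : Fin n × Fin n // (p.1 : ℕ) + (p.2 : ℕ) < n}

namespace Box

variable {n : ℕ}

/-- The row of a box. -/
def row (c : Box n) : ℕ := (c.1.1 : ℕ)

/-- The column of a box. -/
def col (c : Box n) : ℕ := (c.1.2 : ℕ)

/-- The box is on the diagonal, that is, it is the last box of its row. -/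
def OnDiagonal (c : Box n) : Prop := c.row + c.col + 1 = n

instance (c : Box n) : Decidable c.OnDiagonal :=
  inferInstanceAs (Decidable (c.row + c.col + 1 = n))

/-- `d` is in the same row as `c` and strictly to its left. -/
def IsLeftOf (d c : Box n) : Prop := d.row = c.row ∧ d.col < c.col

instance (d c : Box n) : Decidable (d.IsLeftOf c) :=
  inferInstanceAs (Decidable (d.row = c.row ∧ d.col < c.col))

/-- `d` is in the same column as `c` and strictly above it. -/
def IsAbove (d c : Box n) : Prop := d.col = c.col ∧ d.row < c.row

instance (d c : Box n) : Decidable (d.IsAbove c) :=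
  inferInstanceAs (Decidable (d.col = c.col ∧ d.row < c.row))

end Box

/-- Staircase tableaux of size `n`: a box is either empty (`none`) or labeled. -/
def IsStaircaseTableau {n : ℕ} (T : Box n → Option Label) : Prop :=
  (∀ c : Box n, c.OnDiagonal → T c ≠ none) ∧
  (∀ c d : Box n, (T c = some Label.beta ∨ T c = some Label.delta) →
    d.IsLeftOf c → T d = none) ∧
  (∀ c d : Box n, (T c = some Label.alpha ∨ T c = some Label.gamma) →
    d.IsAbove c → T d = none)

instance {n : ℕ} (T : Box n → Option Label) : Decidable (IsStaircaseTableau T) := by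
  unfold IsStaircaseTableau
  infer_instance

/-- The type of staircase tableaux of size `n`. -/
abbrev StaircaseTableau (n : ℕ) : Type := {T : Box n → Option Label // IsStaircaseTableau T}

namespace StaircaseTableau

variable {n : ℕ}

/-- The closest labeled box to the right of `c`, in the row of `c`, has label `x`. -/
def SeesRight (T : StaircaseTableau n) (c : Box n) (x : Label) : Prop :=
  ∃ d : Box n, c.IsLeftOf d ∧ T.1 d = some x ∧
    ∀ e : Box n, c.IsLeftOf e → e.IsLeftOf d → T.1 e = none

instance (T : StaircaseTableau n) (c : Box n) (x : Label) : Decidable (T.SeesRight c x) := by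
  unfold SeesRight
  infer_instance

/-- The closest labeled box below `c`, in the column of `c`, has label `x`. -/
def SeesBelow (T : StaircaseTableau n) (c : Box n) (x : Label) : Prop :=
  ∃ d : Box n, c.IsAbove d ∧ T.1 d = some x ∧
    ∀ e : Box n, c.IsAbove e → e.IsAbove d → T.1 e = none

instance (T : StaircaseTableau n) (c : Box n) (x : Label) : Decidable (T.SeesBelow c x) := by
  unfold SeesBelow
  infer_instance

/-- The blank box `c` receives a `q` (the other blank boxes receive a `1`). -/
def GetsQ (T : StaircaseTableau n) (c : Box n) : Prop :=
  T.SeesRight c Label.delta ∨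
    ((T.SeesRight c Label.alpha ∨ T.SeesRight c Label.gamma) ∧
      (T.SeesBelow c Label.beta ∨ T.SeesBelow c Label.gamma))

instance (T : StaircaseTableau n) (c : Box n) : Decidable (T.GetsQ c) := by
  unfold GetsQ
  infer_instance

/-- The weight of a staircase tableau: the product of the labels of all boxes, where the four
labels take the values `a`, `b`, `g`, `d` and blank boxes carry `q` or `1`. -/
def weight {R : Type*} [CommSemiring R] (a b g d q : R) (T : StaircaseTableau n) : R :=
  ∏ c : Box n,
    match T.1 c with
    | some Label.alpha => a
    | some Label.beta => b
    | some Label.gamma => g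
    | some Label.delta => d
    | none => if T.GetsQ c then q else 1

/-- `t(T)`: the number of labels `α` or `δ` along the diagonal. -/
def t (T : StaircaseTableau n) : ℕ :=
  (Finset.univ.filter fun c : Box n =>
    c.OnDiagonal ∧ (T.1 c = some Label.alpha ∨ T.1 c = some Label.delta)).card

/-- The tableau has no label `γ`. -/
def GammaFree (T : StaircaseTableau n) : Prop := ∀ c : Box n, T.1 c ≠ some Label.gamma

instance (T : StaircaseTableau n) : Decidable T.GammaFree := by
  unfold GammaFree
  infer_instance

/-- The number of `γ`-free staircase tableaux of size `n` with exactly `k` labels `α` or `δ`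
on the diagonal, for an arbitrary integer `k`. -/
def gammaFreeCount (n : ℕ) (k : ℤ) : ℕ :=
  (Finset.univ.filter fun T : StaircaseTableau n => T.GammaFree ∧ (T.t : ℤ) = k).card

/-- The fugacity partition function `Z_n(y; a, b, g, d; q)`, as a polynomial in `y`. -/
noncomputable def fugacityPartition {R : Type*} [CommSemiring R] (n : ℕ) (a b g d q : R) : R[X] :=
  ∑ T : StaircaseTableau n, C (T.weight a b g d q) * X ^ T.t

end StaircaseTableau

/-- A real polynomial is stable if it has no zero in the open upper half-plane. -/
def IsStablePoly (P : ℝ[X]) : Prop := ∀ z : ℂ, 0 < z.im → aeval z P ≠ 0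

/-- A real polynomial is Hurwitz stable if all its complex zeros have negative real part. -/
def IsHurwitzStablePoly (P : ℝ[X]) : Prop := ∀ z : ℂ, 0 ≤ z.re → aeval z P ≠ 0

/-- A real polynomial is log-concave if its coefficients form a log-concave sequence of
nonnegative numbers. -/
def IsLogConcavePoly (P : ℝ[X]) : Prop :=
  (∀ k : ℕ, 0 ≤ P.coeff k) ∧ ∀ k : ℕ, P.coeff k * P.coeff (k + 2) ≤ P.coeff (k + 1) ^ 2

/-! With γ = 0 and all other parameters 1, `fugacityPartition` counts γ-free tableaux by t. The
count is refined by a variable x marking open rows, those with no β or δ. Deleting the first column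
leaves a smaller staircase, and the deleted column can carry labels only in its open rows and in its
diagonal box. Summing over the column gives a recurrence that shifts x by 2
(`two_mul_gammaFreeSum_succ`). By induction it becomes, at fixed x, a first-order differential
recurrence in y (`gammaFreeSum_succ`). At x = 1, comparing coefficients gives the recurrence for
T(n,k).

For the roots, the differential operator is a derivative up to an integrating factor that vanishes
at -1 and 0. Rolle's theorem then turns n zeros in ]-1,0[ into n+1 (`exists_root_between`,
`exists_card_succ_roots`). The degree is at most n, so these are all the zeros. Stability follows,
and log-concavity follows from the factorization into factors X + r with r > 0. -/

/-! ### Generating function of a single column -/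

theorem Label.univ_eq :
    (Finset.univ : Finset Label) = {Label.alpha, Label.beta, Label.gamma, Label.delta} := rfl

theorem Label.sum_option {M : Type*} [AddCommMonoid M] (g : Option Label → M) :
    ∑ l, g l = g none + (g (some .alpha) + (g (some .beta) +
      (g (some .gamma) + g (some .delta)))) := by
  rw [Fintype.sum_option, Label.univ_eq]
  simp

/-- A label which forces the boxes to its left to be empty. -/
def Label.ClosesRow (l : Option Label) : Prop := l = some Label.beta ∨ l = some Label.delta

instance (l : Option Label) : Decidable (Label.ClosesRow l) :=
  inferInstanceAs (Decidable (_ ∨ _))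

/-- Admissible `γ`-free fillings of a stack of boxes, where only the rows in `O` may be used. -/
def IsColumnFilling {m : ℕ} (O : Fin m → Prop) (f : Fin m → Option Label) : Prop :=
  (∀ i, ¬ O i → f i = none) ∧ (∀ i, f i ≠ some Label.gamma) ∧
    ∀ i j, j < i → f i = some Label.alpha → f j = none

instance {m : ℕ} (O : Fin m → Prop) [DecidablePred O] (f : Fin m → Option Label) :
    Decidable (IsColumnFilling O f) := by
  unfold IsColumnFilling
  infer_instance

theorem isColumnFilling_snoc {m : ℕ} (O : Fin (m + 1) → Prop) (f : Fin m → Option Label)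
    (l : Option Label) :
    IsColumnFilling O (Fin.snoc f l : Fin (m + 1) → Option Label) ↔
      IsColumnFilling (fun i => O i.castSucc) f ∧ (¬ O (Fin.last m) → l = none) ∧
        l ≠ some Label.gamma ∧ (l = some Label.alpha → f = fun _ => none) := by
  unfold IsColumnFilling
  simp only [Fin.forall_fin_succ', Fin.snoc_castSucc, Fin.snoc_last, Fin.castSucc_lt_castSucc_iff,
    Fin.castSucc_lt_last, funext_iff, lt_irrefl, (Fin.castSucc_lt_last _).not_gt, false_implies,
    true_implies, and_true]
  grind

theorem isColumnFilling_none {m : ℕ} (O : Fin m → Prop) :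
    IsColumnFilling O (fun _ => none) := by
  simp [IsColumnFilling]

theorem sum_snoc {m : ℕ} {M : Type*} [AddCommMonoid M] (g : (Fin (m + 1) → Option Label) → M) :
    ∑ f, g f = ∑ l, ∑ f : Fin m → Option Label, g (Fin.snoc f l) := by
  rw [← (Fin.snocEquiv fun _ => Option Label).sum_comp, Fintype.sum_prod_type]
  rfl

section

variable {R : Type*} [CommRing R]

/-- Each row of `O` that remains open after inserting the filling `f` contributes `x`. -/
def columnWeight {m : ℕ} (O : Fin m → Prop) [DecidablePred O] (x : R)
    (f : Fin m → Option Label) : R :=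
  ∏ i, if O i ∧ ¬ Label.ClosesRow (f i) then x else 1

/-- The product of `x` over the rows in `O`. -/
def rowWeight {m : ℕ} (O : Fin m → Prop) [DecidablePred O] (x : R) : R :=
  ∏ i, if O i then x else 1

theorem columnWeight_snoc {m : ℕ} (O : Fin (m + 1) → Prop) [DecidablePred O] (x : R)
    (f : Fin m → Option Label) (l : Option Label) :
    columnWeight O x (Fin.snoc f l : Fin (m + 1) → Option Label) =
      columnWeight (fun i => O i.castSucc) x f *
        if O (Fin.last m) ∧ ¬ Label.ClosesRow l then x else 1 := by
  simp [columnWeight, Fin.prod_univ_castSucc]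

theorem columnWeight_none {m : ℕ} (O : Fin m → Prop) [DecidablePred O] (x : R) :
    columnWeight O x (fun _ => none) = rowWeight O x := by
  simp [columnWeight, rowWeight, Label.ClosesRow]

theorem rowWeight_succ {m : ℕ} (O : Fin (m + 1) → Prop) [DecidablePred O] (x : R) :
    rowWeight O x = rowWeight (fun i => O i.castSucc) x * if O (Fin.last m) then x else 1 := by
  simp [rowWeight, Fin.prod_univ_castSucc]

theorem sum_filling_none {m : ℕ} (O : Fin m → Prop) [DecidablePred O] (x : R) :
    (∑ f : Fin m → Option Label,
      if IsColumnFilling O f ∧ f = (fun _ => none) then columnWeight O x f else 0) =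
      rowWeight O x := by
  rw [Finset.sum_eq_single (fun _ => none)]
  · simp [isColumnFilling_none, columnWeight_none]
  · intro f _ hf
    simp [hf]
  · simp

/-- Induction on the bottom box. In an open row, blank gives x, β and δ close the row and give 1
each, and α gives x but empties everything above. Hence F = (x + 2) F' + x W'(x), where F is the
sum, W the row weight, and primes omit the bottom row. The factor 2 avoids division in R. -/
theorem two_mul_sum_columnFilling {m : ℕ} (O : Fin m → Prop) [DecidablePred O] (x : R) :
    2 * (∑ f : Fin m → Option Label, if IsColumnFilling O f then columnWeight O x f else 0) =
      (x + 2) * rowWeight O (x + 2) - x * rowWeight O x := by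
  induction m with
  | zero =>
    rw [Fintype.sum_unique]
    simp [IsColumnFilling, columnWeight, rowWeight]
  | succ m ih =>
    rw [sum_snoc, Label.sum_option]
    simp only [isColumnFilling_snoc, columnWeight_snoc, rowWeight_succ O]
    have ih' := ih (fun i => O i.castSucc)
    have h0 := sum_filling_none (fun i => O i.castSucc) x
    set O' : Fin m → Prop := fun i => O i.castSucc
    by_cases hO : O (Fin.last m)
    · simp only [hO, Label.ClosesRow, not_true, false_implies, true_and, ne_eq, reduceCtorEq,
        not_false_eq_true, and_true, Option.some.injEq, or_self, or_false, false_or, if_true,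
        and_false, if_false, Finset.sum_const_zero, mul_one, true_implies]
      simp only [← ite_zero_mul, ← Finset.sum_mul, h0]
      linear_combination (x + 2) * ih'
    · simp only [hO, Label.ClosesRow, not_false_eq_true, true_implies, reduceCtorEq, false_implies,
        false_and, and_false, ne_eq, if_false, Finset.sum_const_zero, mul_one, and_true]
      linear_combination ih'

/-- The generating function of the nonempty bottom label of a column and the labels above it. -/
theorem two_mul_sum_column {m : ℕ} (O : Fin m → Prop) [DecidablePred O] (x y : R) :
    2 * (∑ l : Option Label, ∑ f : Fin m → Option Label,
      if IsColumnFilling O f ∧ l ≠ none ∧ l ≠ some Label.gamma ∧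
          (l = some Label.alpha → f = fun _ => none) then
        columnWeight O x f * (if ¬ Label.ClosesRow l then x else 1) *
          (if l = some Label.alpha ∨ l = some Label.delta then y else 1) else 0) =
      (1 + y) * ((x + 2) * rowWeight O (x + 2)) + (y - 1) * (x * rowWeight O x) := by
  rw [Label.sum_option]
  have h0 := sum_filling_none O x
  have h1 := two_mul_sum_columnFilling O x
  simp only [Label.ClosesRow, ne_eq, not_true, reduceCtorEq, not_false_eq_true, true_and,
    false_implies, and_true, and_false, if_false, Finset.sum_const_zero, mul_one,
    Option.some.injEq, or_self, or_false, false_or, if_true, true_implies]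
  simp only [← ite_zero_mul, ← Finset.sum_mul, h0]
  -- β and δ at the bottom contribute (1 + y) times the column sum; α contributes y x `rowWeight O
  -- x`, since it empties the column above.
  linear_combination (1 + y) * h1

end

/-! ### Deleting the first column of a staircase -/

namespace Box

variable {n : ℕ}

/-- The `i`-th box of the first column. -/
def firstColumn (i : Fin (n + 1)) : Box (n + 1) := ⟨(i, 0), by simp [Fin.is_le]⟩

/-- A box of the diagram with the first column deleted. -/
def shiftRight (c : Box n) : Box (n + 1) :=
  ⟨(c.1.1.castSucc, c.1.2.succ), by
    have := c.2
    simp only [Fin.val_castSucc, Fin.val_succ]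
    omega⟩

@[simp] theorem row_firstColumn (i : Fin (n + 1)) : (firstColumn i).row = i := rfl
@[simp] theorem col_firstColumn (i : Fin (n + 1)) : (firstColumn i).col = 0 := rfl
@[simp] theorem row_shiftRight (c : Box n) : c.shiftRight.row = c.row := rfl
@[simp] theorem col_shiftRight (c : Box n) : c.shiftRight.col = c.col + 1 := rfl

theorem bijective_sumElim_firstColumn_shiftRight :
    Function.Bijective (Sum.elim (firstColumn (n := n)) shiftRight) := by
  constructor
  · rintro (i | c) (j | d) h
    · exact congrArg Sum.inl (congrArg (fun c : Box (n + 1) => c.1.1) h)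
    · have := congrArg col h
      simp at this
    · have := congrArg col h
      simp at this
    · have h1 := congrArg row h
      have h2 := congrArg col h
      simp only [Sum.elim_inr, row_shiftRight, col_shiftRight, Nat.add_right_cancel_iff] at h1 h2
      exact congrArg Sum.inr (Subtype.ext (Prod.ext (Fin.ext h1) (Fin.ext h2)))
  · rintro ⟨⟨i, j⟩, h⟩
    rcases Fin.eq_zero_or_eq_succ j with rfl | ⟨j, rfl⟩
    · exact ⟨Sum.inl i, rfl⟩
    · simp only [Fin.val_succ] at h
      exact ⟨Sum.inr ⟨(⟨i, by omega⟩, j), by simp only; omega⟩, rfl⟩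

/-- The staircase is its first column together with a smaller staircase. -/
noncomputable def sumEquiv (n : ℕ) : Fin (n + 1) ⊕ Box n ≃ Box (n + 1) :=
  Equiv.ofBijective _ bijective_sumElim_firstColumn_shiftRight

@[simp] theorem sumEquiv_inl (i : Fin (n + 1)) : sumEquiv n (Sum.inl i) = firstColumn i := rfl
@[simp] theorem sumEquiv_inr (c : Box n) : sumEquiv n (Sum.inr c) = shiftRight c := rfl

theorem forall_succ {p : Box (n + 1) → Prop} :
    (∀ c, p c) ↔ (∀ i, p (firstColumn i)) ∧ ∀ c, p (shiftRight c) := by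
  rw [(sumEquiv n).surjective.forall, Sum.forall]
  rfl

theorem prod_succ {M : Type*} [CommMonoid M] (g : Box (n + 1) → M) :
    ∏ c, g c = (∏ i, g (firstColumn i)) * ∏ c, g (shiftRight c) := by
  rw [← (sumEquiv n).prod_comp, Fintype.prod_sum_type]
  rfl

end Box

/-- Put a column of labels to the left of a filling of a smaller staircase. -/
noncomputable def consColumn {n : ℕ} (f : Fin (n + 1) → Option Label) (T : Box n → Option Label) :
    Box (n + 1) → Option Label :=
  fun c => Sum.elim f T ((Box.sumEquiv n).symm c)

section

variable {n : ℕ} (f : Fin (n + 1) → Option Label) (T : Box n → Option Label)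

@[simp] theorem consColumn_firstColumn (i : Fin (n + 1)) :
    consColumn f T (Box.firstColumn i) = f i := by
  rw [consColumn, ← Box.sumEquiv_inl, Equiv.symm_apply_apply]
  rfl

@[simp] theorem consColumn_shiftRight (c : Box n) :
    consColumn f T c.shiftRight = T c := by
  rw [consColumn, ← Box.sumEquiv_inr, Equiv.symm_apply_apply]
  rfl

theorem sum_consColumn {M : Type*} [AddCommMonoid M] (g : (Box (n + 1) → Option Label) → M) :
    ∑ T, g T = ∑ T : Box n → Option Label, ∑ f, g (consColumn f T) := by
  rw [← ((Box.sumEquiv n).arrowCongr (Equiv.refl (Option Label))).sum_comp,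
    ← (Equiv.sumArrowEquivProdArrow _ _ _).symm.sum_comp, Fintype.sum_prod_type_right]
  rfl

end

/-- The row `i` has no label `β` or `δ`. -/
def IsOpenRow {n : ℕ} (T : Box n → Option Label) (i : ℕ) : Prop :=
  ∀ c : Box n, c.row = i → ¬ Label.ClosesRow (T c)

instance {n : ℕ} (T : Box n → Option Label) (i : ℕ) : Decidable (IsOpenRow T i) := by
  unfold IsOpenRow
  infer_instance

/-- A staircase tableau without the label `γ`. -/
def IsGammaFreeTableau {n : ℕ} (T : Box n → Option Label) : Prop :=
  IsStaircaseTableau T ∧ ∀ c, T c ≠ some Label.gamma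

instance {n : ℕ} (T : Box n → Option Label) : Decidable (IsGammaFreeTableau T) := by
  unfold IsGammaFreeTableau
  infer_instance

theorem isOpenRow_consColumn {n : ℕ} (f : Fin (n + 1) → Option Label) (T : Box n → Option Label)
    (i : Fin (n + 1)) :
    IsOpenRow (consColumn f T) i ↔ IsOpenRow T i ∧ ¬ Label.ClosesRow (f i) := by
  simp only [IsOpenRow, Box.forall_succ, Box.row_firstColumn, Box.row_shiftRight,
    consColumn_firstColumn, consColumn_shiftRight, Fin.val_inj, forall_eq, and_comm]

theorem isOpenRow_self {n : ℕ} (T : Box n → Option Label) : IsOpenRow T n :=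
  fun c hc => absurd hc c.1.1.2.ne

/-- The new column meets the old tableau only through rows: a β or δ in row i blanks the new box of
that row. The bottom row consists of its diagonal box alone, so no row constrains l. -/
theorem isGammaFreeTableau_consColumn {n : ℕ} (f : Fin n → Option Label) (l : Option Label)
    (T : Box n → Option Label) :
    IsGammaFreeTableau (consColumn (Fin.snoc f l : Fin (n + 1) → Option Label) T) ↔
      IsGammaFreeTableau T ∧ IsColumnFilling (fun i : Fin n => IsOpenRow T i) f ∧ l ≠ none ∧
        l ≠ some Label.gamma ∧ (l = some Label.alpha → f = fun _ => none) := by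
  have hne : ∀ i : Fin n, (i : ℕ) ≠ n := fun i => i.2.ne
  have hlt : ∀ i : Fin n, ¬ n < i := fun i => i.2.le.not_gt
  simp only [IsGammaFreeTableau, IsStaircaseTableau, Box.forall_succ, Box.OnDiagonal, Box.IsLeftOf,
    Box.IsAbove, Box.row_firstColumn, Box.row_shiftRight, Box.col_firstColumn, Box.col_shiftRight,
    consColumn_firstColumn, consColumn_shiftRight, Fin.forall_fin_succ', Fin.snoc_castSucc,
    Fin.snoc_last, Fin.val_castSucc, Fin.val_last, IsColumnFilling, IsOpenRow, Label.ClosesRow,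
    funext_iff, Nat.add_right_cancel_iff, Nat.add_lt_add_iff_right, Nat.not_lt_zero, and_false,
    false_implies, implies_true, true_and, add_zero, hne, hlt, lt_irrefl, Fin.is_lt, and_true,
    true_implies, (Nat.succ_ne_zero _), (Nat.succ_ne_zero _).symm, false_and, Nat.zero_lt_succ]
  have hassoc : ∀ c : Box n, c.row + (c.col + 1) = c.row + c.col + 1 := fun c => rfl
  simp only [hassoc]
  constructor
  · rintro ⟨⟨⟨hl, h1⟩, h2, ⟨h3, h4⟩, h5⟩, ⟨h6, h7⟩, h8⟩
    refine ⟨⟨⟨h1, fun c => (h2 c).2, h5⟩, h8⟩, ⟨fun i hi => ?_, h6, fun i j hji hi =>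
      h3 i j (Or.inl hi) hji⟩, hl, h7, fun h i => h4 i (Or.inl h)⟩
    push Not at hi
    obtain ⟨c, hc, hT⟩ := hi
    exact (h2 c).1.1 i hT hc.symm
  · rintro ⟨⟨⟨h1, h2, h5⟩, h8⟩, ⟨h3, h6, h4⟩, hl, h7, h9⟩
    refine ⟨⟨⟨hl, h1⟩, fun c => ⟨⟨fun i hT hi => h3 i fun h => h c hi.symm hT,
      fun _ hc => absurd hc.symm c.1.1.2.ne⟩, h2 c⟩, ⟨fun i j hi hji => ?_, fun i hi => ?_⟩, h5⟩,
      ⟨h6, h7⟩, h8⟩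
    · exact h4 i j hji (hi.resolve_right (h6 i))
    · exact h9 (hi.resolve_right h7) i

/-! ### Recurrences for the refined generating function -/

section

variable {R : Type*} [CommRing R]

/-- The product of `y` over the diagonal boxes with label `α` or `δ`. -/
def diagonalWeight {n : ℕ} (T : Box n → Option Label) (y : R) : R :=
  ∏ c : Box n,
    if c.OnDiagonal ∧ (T c = some Label.alpha ∨ T c = some Label.delta) then y else 1

/-- The generating function of the `γ`-free staircase tableaux of size `n`, where `x` marks the rows
without label `β` or `δ` and `y` marks the diagonal boxes with label `α` or `δ`. -/
def gammaFreeSum (n : ℕ) (x y : R) : R :=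
  ∑ T : Box n → Option Label, if IsGammaFreeTableau T then
    diagonalWeight T y * rowWeight (fun i : Fin n => IsOpenRow T i) x else 0

theorem diagonalWeight_consColumn {n : ℕ} (f : Fin n → Option Label) (l : Option Label)
    (T : Box n → Option Label) (y : R) :
    diagonalWeight (consColumn (Fin.snoc f l : Fin (n + 1) → Option Label) T) y =
      (if l = some Label.alpha ∨ l = some Label.delta then y else 1) * diagonalWeight T y := by
  have hne : ∀ i : Fin n, (i : ℕ) ≠ n := fun i => i.2.ne
  simp only [diagonalWeight, Box.prod_succ, Box.OnDiagonal, Box.row_firstColumn,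
    Box.row_shiftRight, Box.col_firstColumn, Box.col_shiftRight, consColumn_firstColumn,
    consColumn_shiftRight, Fin.prod_univ_castSucc, Fin.snoc_castSucc, Fin.snoc_last,
    Fin.val_castSucc, Fin.val_last, add_zero, Nat.add_right_cancel_iff, hne, false_and, if_false,
    Finset.prod_const_one, one_mul, true_and, ← add_assoc]
  rfl

theorem rowWeight_consColumn {n : ℕ} (f : Fin n → Option Label) (l : Option Label)
    (T : Box n → Option Label) (x : R) :
    rowWeight (fun i : Fin (n + 1) =>
        IsOpenRow (consColumn (Fin.snoc f l : Fin (n + 1) → Option Label) T) i) x =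
      columnWeight (fun i : Fin n => IsOpenRow T i) x f *
        if ¬ Label.ClosesRow l then x else 1 := by
  simp only [rowWeight, isOpenRow_consColumn, Fin.prod_univ_castSucc, Fin.snoc_castSucc,
    Fin.snoc_last, Fin.val_castSucc, Fin.val_last, isOpenRow_self, true_and, columnWeight]

theorem two_mul_gammaFreeSum_succ (n : ℕ) (x y : R) :
    2 * gammaFreeSum (n + 1) x y =
      (1 + y) * ((x + 2) * gammaFreeSum n (x + 2) y) + (y - 1) * (x * gammaFreeSum n x y) := by
  unfold gammaFreeSum
  rw [sum_consColumn]
  simp only [Finset.mul_sum, ← Finset.sum_add_distrib]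
  refine Finset.sum_congr rfl fun T _ => ?_
  rw [sum_snoc]
  simp only [isGammaFreeTableau_consColumn, diagonalWeight_consColumn, rowWeight_consColumn]
  by_cases hT : IsGammaFreeTableau T
  · simp only [hT, true_and, if_true]
    have h := two_mul_sum_column (fun i : Fin n => IsOpenRow T i) x y
    rw [Finset.mul_sum] at h
    simp only [Finset.mul_sum] at h
    calc _ = diagonalWeight T y * _ := ?_
      _ = diagonalWeight T y * _ := congrArg _ h
      _ = _ := by ring
    simp only [Finset.mul_sum]
    refine Finset.sum_congr rfl fun l _ => Finset.sum_congr rfl fun f _ => ?_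
    split_ifs <;> ring
  · simp [hT]

theorem gammaFreeSum_zero (x y : R) : gammaFreeSum 0 x y = 1 := by
  unfold gammaFreeSum
  rw [Fintype.sum_unique]
  simp [IsGammaFreeTableau, IsStaircaseTableau, diagonalWeight, rowWeight]

end

/-- The differential operators intertwine with the shift recurrence. Differentiating the factor 1 +
y adds y(1 - y) to the multiplier, which accounts for replacing x by x + 2; differentiating y - 1
subtracts y(1 + y), which accounts for x itself. The induction needs the statement at both x and x +
2, hence for all x. -/
theorem gammaFreeSum_succ (n : ℕ) (x : ℝ) :
    gammaFreeSum (n + 1) (C x) (X : ℝ[X]) =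
      (1 + C (n + 1 + x) * X + C (n : ℝ) * X ^ 2) * gammaFreeSum n (C x) X +
        X * (1 - X ^ 2) * derivative (gammaFreeSum n (C x) X) := by
  have h2 : (2 : ℝ[X]) ≠ 0 := two_ne_zero
  have hC : ∀ x : ℝ, (C x + 2 : ℝ[X]) = C (x + 2) := fun x => by rw [C_add]; rfl
  induction n generalizing x with
  | zero =>
    refine mul_left_cancel₀ h2 ?_
    rw [two_mul_gammaFreeSum_succ]
    simp only [gammaFreeSum_zero, derivative_one, Nat.cast_zero, map_add, map_one, map_zero]
    ring
  | succ n ih =>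
    refine mul_left_cancel₀ h2 ?_
    have e1 := two_mul_gammaFreeSum_succ (n + 1) (C x) (X : ℝ[X])
    have e0 := two_mul_gammaFreeSum_succ n (C x) (X : ℝ[X])
    have ed := congrArg derivative e0
    rw [hC] at e1 e0 ed
    rw [ih x, ih (x + 2)] at e1
    simp only [derivative_mul, derivative_add, derivative_sub, derivative_C, derivative_X,
      derivative_one, derivative_ofNat] at ed
    simp only [Nat.cast_add, Nat.cast_one, C_add, C_1] at e1 ⊢
    have hx : C x + C (2 : ℝ) = C (x + 2) := C_add.symm
    have hc2 : C (2 : ℝ) = 2 := rfl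
    rw [← hx, hc2] at e0 ed
    rw [hc2] at e1
    linear_combination e1 - (1 + (C (n : ℝ) + 1 + 1 + C x) * X + (C (n : ℝ) + 1) * X ^ 2) * e0
      - X * (1 - X ^ 2) * ed

/-! ### Log-concavity of products of linear factors -/

/-- Log-concavity in a form which is stable under multiplication by linear factors. -/
def IsStronglyLogConcave (P : ℝ[X]) : Prop :=
  (∀ k, 0 ≤ P.coeff k) ∧
    ∀ i j, i ≤ j → P.coeff i * P.coeff (j + 2) ≤ P.coeff (i + 1) * P.coeff (j + 1)

theorem IsStronglyLogConcave.isLogConcavePoly {P : ℝ[X]} (h : IsStronglyLogConcave P) :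
    IsLogConcavePoly P :=
  ⟨h.1, fun k => by rw [sq]; exact h.2 k k le_rfl⟩

theorem isStronglyLogConcave_C {c : ℝ} (hc : 0 ≤ c) : IsStronglyLogConcave (C c) := by
  refine ⟨fun k => ?_, fun i j _ => ?_⟩
  · rw [coeff_C]
    split_ifs <;> simp [hc]
  · simp [coeff_C]

/-- The inequality is compared by powers of r: the constant and r² parts are instances of the
hypothesis, and the r part reduces to `hgap` after cancelling a common term. Adjacent inequalities
alone would not suffice: 1, 0, 0, 1 satisfies them, but its product with X + 1 does not. -/
theorem IsStronglyLogConcave.mul_X_add_C {P : ℝ[X]} (h : IsStronglyLogConcave P) {r : ℝ}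
    (hr : 0 ≤ r) : IsStronglyLogConcave (P * (X + C r)) := by
  obtain ⟨h0, h1⟩ := h
  have hs : ∀ k, (P * (X + C r)).coeff (k + 1) = P.coeff k + P.coeff (k + 1) * r := fun k => by
    rw [mul_add, coeff_add, coeff_mul_X, coeff_mul_C]
  have hz : (P * (X + C r)).coeff 0 = P.coeff 0 * r := by
    simp [mul_add]
  have hgap : ∀ i j, i ≤ j → P.coeff i * P.coeff (j + 3) ≤ P.coeff (i + 2) * P.coeff (j + 1) := by
    intro i j hij
    refine (h1 i (j + 1) (by omega)).trans ?_
    rcases hij.eq_or_lt with rfl | hlt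
    · exact (mul_comm _ _).le
    · obtain ⟨j, rfl⟩ : ∃ l, j = l + 1 := ⟨j - 1, by omega⟩
      exact h1 (i + 1) (j + 1) (by omega)
  refine ⟨fun k => ?_, fun i j hij => ?_⟩
  · cases k with
    | zero => rw [hz]; exact mul_nonneg (h0 0) hr
    | succ k => rw [hs]; exact add_nonneg (h0 k) (mul_nonneg (h0 _) hr)
  · have hr2 : 0 ≤ r * r := mul_nonneg hr hr
    cases i with
    | zero =>
      rw [hz, hs, hs, hs]
      have e1 := mul_le_mul_of_nonneg_right (h1 0 j (by omega)) hr2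
      have e2 : 0 ≤ P.coeff 0 * P.coeff j := mul_nonneg (h0 _) (h0 _)
      have e3 : 0 ≤ P.coeff 1 * P.coeff j * r := mul_nonneg (mul_nonneg (h0 _) (h0 _)) hr
      simp only [zero_add] at *
      linarith
    | succ i =>
      obtain ⟨j, rfl⟩ : ∃ l, j = l + 1 := ⟨j - 1, by omega⟩
      simp only [hs]
      have e1 := mul_le_mul_of_nonneg_right (h1 (i + 1) (j + 1) (by omega)) hr2
      have e2 := h1 i j (by omega)
      have e3 := mul_le_mul_of_nonneg_right (hgap i j (by omega)) hr
      simp only [add_assoc, Nat.reduceAdd] at *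
      linarith

theorem isStronglyLogConcave_C_mul_prod {c : ℝ} (hc : 0 ≤ c) (S : Finset ℝ)
    (hS : ∀ s ∈ S, s ≤ 0) : IsStronglyLogConcave (C c * ∏ s ∈ S, (X - C s)) := by
  induction S using Finset.induction_on with
  | empty => simpa using isStronglyLogConcave_C hc
  | insert a S ha ih =>
    rw [Finset.prod_insert ha, mul_comm (X - C a), ← mul_assoc, sub_eq_add_neg, ← C_neg]
    exact (ih fun s hs => hS s (Finset.mem_insert_of_mem hs)).mul_X_add_C
      (by linarith [hS a (Finset.mem_insert_self a S)])

/-! ### Real roots by Rolle's theorem -/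

theorem Polynomial.eq_C_mul_prod_of_card_roots {P : ℝ[X]} (hP : P ≠ 0) (S : Finset ℝ)
    (hroot : ∀ s ∈ S, P.eval s = 0) (hdeg : P.natDegree ≤ S.card) :
    P = C P.leadingCoeff * ∏ s ∈ S, (X - C s) := by
  have hle : S.val ≤ P.roots := by
    rw [Finset.val_le_iff_val_subset]
    intro s hs
    exact (mem_roots hP).2 (hroot s hs)
  have hroots : S.val = P.roots :=
    Multiset.eq_of_le_of_card_le hle ((card_roots' P).trans hdeg)
  have hcard : Multiset.card P.roots = P.natDegree :=
    le_antisymm (card_roots' P) (by rw [← hroots]; exact hdeg)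
  conv_lhs => rw [← C_leadingCoeff_mul_prod_multiset_X_sub_C hcard, ← hroots]
  rfl

/-- The critical points of `y √(1 + y) (1 - y) ^ (-m - 1/2) P(y)` in `]-1, 0[` are zeros of `Q`. -/
theorem exists_root_between {P Q : ℝ[X]} (m : ℝ)
    (hQ : Q = (1 + C (m + 1) * X + C (m - 1) * X ^ 2) * P + X * (1 - X ^ 2) * derivative P)
    {a b : ℝ} (hab : a < b) (ha : -1 ≤ a) (hb : b ≤ 0)
    (ha0 : a = -1 ∨ P.eval a = 0) (hb0 : b = 0 ∨ P.eval b = 0) :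
    ∃ z, a < z ∧ z < b ∧ Q.eval z = 0 := by
  -- The prefactor has logarithmic derivative 1/y + 1/(2(1 + y)) + (m + 1/2)/(1 - y), which is (1 +
  -- (m + 1)y + (m - 1)y²) / (y(1 - y²)).
  let g : ℝ → ℝ := fun y => y * √(1 + y) * (1 - y) ^ (-m - 1 / 2) * P.eval y
  have hcont : ContinuousOn g (Set.Icc a b) := by
    refine ContinuousOn.mul (ContinuousOn.mul (by fun_prop) ?_) P.continuous.continuousOn
    refine ContinuousOn.rpow_const (by fun_prop) fun y hy => Or.inl ?_
    have := hy.2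
    linarith
  have hga : g a = 0 := by
    rcases ha0 with rfl | h
    · simp [g]
    · simp [g, h]
  have hgb : g b = 0 := by
    rcases hb0 with rfl | h
    · simp [g]
    · simp [g, h]
  obtain ⟨z, ⟨haz, hzb⟩, hz⟩ := exists_deriv_eq_zero hab hcont (hga.trans hgb.symm)
  refine ⟨z, haz, hzb, ?_⟩
  have h1 : 0 < 1 + z := by linarith
  have h2 : 0 < 1 - z := by linarith
  have hsq : HasDerivAt (fun y : ℝ => √(1 + y)) (1 / (2 * √(1 + z))) z :=
    ((hasDerivAt_id z).const_add 1).sqrt h1.ne'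
  have hpow : HasDerivAt (fun y : ℝ => (1 - y) ^ (-m - 1 / 2))
      (-1 * (-m - 1 / 2) * (1 - z) ^ (-m - 1 / 2 - 1)) z :=
    ((hasDerivAt_id z).const_sub 1).rpow_const (Or.inl h2.ne')
  have hder := (((hasDerivAt_id z).mul hsq).mul hpow).mul (P.hasDerivAt z)
  have hz' := hder.deriv.symm.trans hz
  rw [Real.rpow_sub_one h2.ne'] at hz'
  have hs : 0 < √(1 + z) := Real.sqrt_pos.2 h1
  have hp : 0 < (1 - z) ^ (-m - 1 / 2) := Real.rpow_pos_of_pos h2 _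
  have hss : √(1 + z) ^ 2 = 1 + z := Real.sq_sqrt h1.le
  simp only [Pi.mul_apply, id] at hz'
  generalize √(1 + z) = s at *
  generalize (1 - z) ^ (-m - 1 / 2) = p at *
  have hsi : s * (1 / (2 * s)) = 1 / 2 := by field_simp
  have hpd : (1 - z) * (p / (1 - z)) = p := by field_simp
  rw [hQ]
  simp only [eval_add, eval_mul, eval_sub, eval_one, eval_C, eval_X, eval_pow]
  -- Multiplying g'(z) = 0 by s(1 - z) yields p Q(z) = 0.
  refine (mul_eq_zero.1 (?_ : p * _ = 0)).resolve_left hp.ne'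
  linear_combination (s * (1 - z)) * hz' - z * p * (1 - z) * P.eval z * hsi
    - z * s ^ 2 * (m + 1 / 2) * P.eval z * hpd
    - ((1 - z) * p * P.eval z + z * (m + 1 / 2) * p * P.eval z
      + z * (1 - z) * p * (derivative P).eval z) * hss

/-- If `P` has `n` zeros in `]-1, 0[`, then `Q` has `n + 1` zeros there. -/
theorem exists_card_succ_roots {P Q : ℝ[X]} (m : ℝ)
    (hQ : Q = (1 + C (m + 1) * X + C (m - 1) * X ^ 2) * P + X * (1 - X ^ 2) * derivative P)
    (hQ0 : Q ≠ 0) (S : Finset ℝ) (hS : ∀ s ∈ S, s ∈ Set.Ioo (-1 : ℝ) 0 ∧ P.eval s = 0) :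
    ∃ S' : Finset ℝ, S'.card = S.card + 1 ∧
      ∀ s ∈ S', s ∈ Set.Ioo (-1 : ℝ) 0 ∧ Q.eval s = 0 := by
  classical
  let A : Finset ℝ := insert (-1) (insert 0 S)
  let B : Finset ℝ := Q.roots.toFinset.filter fun s => s ∈ Set.Ioo (-1 : ℝ) 0
  have hA : A.card = S.card + 2 := by
    have h0 : (0 : ℝ) ∉ S := fun h => lt_irrefl _ (hS _ h).1.2
    have h1 : (-1 : ℝ) ∉ insert 0 S := by
      rw [Finset.mem_insert, not_or]
      exact ⟨by norm_num, fun h => lt_irrefl _ (hS _ h).1.1⟩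
    rw [Finset.card_insert_of_notMem h1, Finset.card_insert_of_notMem h0]
  have hmem : ∀ a ∈ A, -1 ≤ a ∧ a ≤ 0 ∧ (a = -1 ∨ a = 0 ∨ P.eval a = 0) := by
    intro a ha
    simp only [A, Finset.mem_insert] at ha
    rcases ha with rfl | rfl | ha
    · norm_num
    · norm_num
    · exact ⟨(hS a ha).1.1.le, (hS a ha).1.2.le, Or.inr (Or.inr (hS a ha).2)⟩
  -- The `S.card + 2` points of A bound `S.card + 1` gaps, each containing a zero of Q.
  have hcard : A.card ≤ (B \ A).card + 1 := by
    refine Finset.card_le_sdiff_of_interleaved fun a ha b hb hab _ => ?_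
    obtain ⟨ha1, ha2, ha3⟩ := hmem a ha
    obtain ⟨hb1, hb2, hb3⟩ := hmem b hb
    obtain ⟨z, haz, hzb, hz⟩ := exists_root_between m hQ hab ha1 hb2
      (by rcases ha3 with h | h | h
          · exact Or.inl h
          · linarith
          · exact Or.inr h)
      (by rcases hb3 with h | h | h
          · linarith
          · exact Or.inl h
          · exact Or.inr h)
    refine ⟨z, ?_, haz, hzb⟩
    simp only [B, Finset.mem_filter, Multiset.mem_toFinset, mem_roots hQ0, IsRoot.def]
    exact ⟨hz, ha1.trans_lt haz, hzb.trans_le hb2⟩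
  have hB : S.card + 1 ≤ B.card := by
    have := Finset.card_le_card (Finset.sdiff_subset : B \ A ⊆ B)
    omega
  obtain ⟨S', hS', hc⟩ := Finset.exists_subset_card_eq hB
  refine ⟨S', hc, fun s hs => ?_⟩
  have := hS' hs
  simp only [B, Finset.mem_filter, Multiset.mem_toFinset, mem_roots hQ0, IsRoot.def] at this
  exact ⟨this.2, this.1⟩

/-! ### The partition function: coefficients, degree and factorization -/

theorem StaircaseTableau.weight_gamma_zero {n : ℕ} (T : StaircaseTableau n) :
    T.weight (1 : ℝ) 1 0 1 1 = if T.GammaFree then 1 else 0 := by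
  unfold weight
  split_ifs with h
  · refine Finset.prod_eq_one fun c _ => ?_
    have hc := h c
    split <;> simp_all
  · unfold GammaFree at h
    push Not at h
    obtain ⟨c, hc⟩ := h
    exact Finset.prod_eq_zero (Finset.mem_univ c) (by rw [hc])

theorem StaircaseTableau.fugacityPartition_eq_sum (n : ℕ) :
    fugacityPartition n (1 : ℝ) 1 0 1 1 =
      ∑ T : StaircaseTableau n, if T.GammaFree then (X : ℝ[X]) ^ T.t else 0 := by
  refine Finset.sum_congr rfl fun T _ => ?_
  rw [weight_gamma_zero]
  split_ifs <;> simp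

/-- At x = 1 the marking of open rows disappears. -/
theorem StaircaseTableau.fugacityPartition_eq_gammaFreeSum (n : ℕ) :
    fugacityPartition n (1 : ℝ) 1 0 1 1 = gammaFreeSum n (C 1) X := by
  rw [fugacityPartition_eq_sum]
  unfold gammaFreeSum
  simp only [IsGammaFreeTableau, ite_and]
  refine Eq.trans ?_ ((Finset.sum_subtype (p := IsStaircaseTableau)
    (F := inferInstanceAs (Fintype (StaircaseTableau n)))
    (Finset.univ.filter IsStaircaseTableau) (by simp) _).symm.trans (Finset.sum_filter _ _))
  refine Finset.sum_congr rfl fun T _ => if_congr Iff.rfl ?_ rfl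
  simp only [rowWeight, C_1, ite_self, Finset.prod_const_one, mul_one]
  rw [diagonalWeight, Finset.prod_ite, Finset.prod_const, Finset.prod_const_one, mul_one]
  rfl

theorem StaircaseTableau.coeff_fugacityPartition (n k : ℕ) :
    (fugacityPartition n (1 : ℝ) 1 0 1 1).coeff k = gammaFreeCount n k := by
  rw [fugacityPartition_eq_sum, finsetSum_coeff, gammaFreeCount, Finset.card_filter, Nat.cast_sum]
  refine Finset.sum_congr rfl fun T _ => ?_
  by_cases h : T.GammaFree <;> simp [h, coeff_X_pow, eq_comm]

theorem StaircaseTableau.gammaFreeCount_of_neg (n : ℕ) {k : ℤ} (hk : k < 0) :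
    gammaFreeCount n k = 0 := by
  rw [gammaFreeCount, Finset.card_eq_zero, Finset.filter_eq_empty_iff]
  rintro T - ⟨-, h⟩
  omega

theorem StaircaseTableau.fugacityPartition_succ (n : ℕ) :
    fugacityPartition (n + 1) (1 : ℝ) 1 0 1 1 =
      (1 + C ((n + 1 : ℝ) + 1) * X + C ((n + 1 : ℝ) - 1) * X ^ 2) *
          fugacityPartition n (1 : ℝ) 1 0 1 1 +
        X * (1 - X ^ 2) * derivative (fugacityPartition n (1 : ℝ) 1 0 1 1) := by
  simp only [fugacityPartition_eq_gammaFreeSum, gammaFreeSum_succ, add_sub_cancel_right]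

theorem StaircaseTableau.gammaFreeCount_succ (n : ℕ) (k : ℤ) :
    (gammaFreeCount (n + 1) k : ℤ) =
      (k + 1) * gammaFreeCount n k + (n + 2) * gammaFreeCount n (k - 1) +
        (n - k + 2) * gammaFreeCount n (k - 2) := by
  have hd : ∀ (P : ℝ[X]) (k : ℕ), (X * derivative P).coeff k = k * P.coeff k := by
    intro P k
    cases k with
    | zero => simp
    | succ k => rw [coeff_X_mul, coeff_derivative]; push_cast; ring
  have hrec : fugacityPartition (n + 1) (1 : ℝ) 1 0 1 1 =
      fugacityPartition n (1 : ℝ) 1 0 1 1 +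
        C (n + 2 : ℝ) * (fugacityPartition n (1 : ℝ) 1 0 1 1 * X) +
        C (n : ℝ) * (fugacityPartition n (1 : ℝ) 1 0 1 1 * X ^ 2) +
        X * derivative (fugacityPartition n (1 : ℝ) 1 0 1 1) -
        X * derivative (fugacityPartition n (1 : ℝ) 1 0 1 1) * X ^ 2 := by
    rw [fugacityPartition_succ, add_sub_cancel_right, add_assoc (n : ℝ), one_add_one_eq_two]
    ring
  rcases lt_or_ge k 0 with hk | hk
  · simp [gammaFreeCount_of_neg, hk, show k - 1 < 0 by omega, show k - 2 < 0 by omega]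
  lift k to ℕ using hk
  have h := congrArg (fun P => coeff P k) hrec
  simp only [coeff_add, coeff_sub, coeff_C_mul, hd] at h
  rcases k with - | - | k
  · rw [coeff_mul_X_zero, coeff_mul_X_pow', coeff_mul_X_pow'] at h
    simp only [coeff_fugacityPartition] at h
    rw [gammaFreeCount_of_neg n (k := _ - 1) (by simp),
      gammaFreeCount_of_neg n (k := _ - 2) (by simp)]
    simp at h ⊢
    exact_mod_cast h
  · rw [coeff_mul_X, coeff_mul_X_pow', coeff_mul_X_pow'] at h
    simp only [coeff_fugacityPartition] at h
    rw [gammaFreeCount_of_neg n (k := _ - 2) (by simp)]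
    simp at h ⊢
    rify
    linear_combination h
  · rw [coeff_mul_X, coeff_mul_X_pow, coeff_mul_X_pow, hd] at h
    simp only [coeff_fugacityPartition] at h
    have e1 : ((k + 1 + 1 : ℕ) : ℤ) - 1 = (k + 1 : ℕ) := by push_cast; ring
    have e2 : ((k + 1 + 1 : ℕ) : ℤ) - 2 = (k : ℕ) := by push_cast; ring
    rw [e1, e2]
    rify
    push_cast at h ⊢
    linear_combination h

theorem StaircaseTableau.gammaFreeCount_of_lt (n : ℕ) {k : ℤ} (hk : (n : ℤ) < k) :
    gammaFreeCount n k = 0 := by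
  induction n generalizing k with
  | zero =>
    rw [gammaFreeCount, Finset.card_eq_zero, Finset.filter_eq_empty_iff]
    rintro T - ⟨-, h⟩
    have : T.t = 0 := Finset.card_eq_zero.2 (Finset.eq_empty_of_isEmpty _)
    rw [this] at h
    exact hk.ne h
  | succ n ih =>
    push_cast at hk
    have h := gammaFreeCount_succ n k
    rw [ih (by omega), ih (by omega)] at h
    -- Only T(n, k - 2) can survive, and only for k = n + 2, where its coefficient n - k + 2
    -- vanishes.
    rcases eq_or_ne k (n + 2) with rfl | hne
    · simpa using h
    · rw [ih (by omega)] at h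
      simpa using h

theorem StaircaseTableau.natDegree_fugacityPartition_le (n : ℕ) :
    (fugacityPartition n (1 : ℝ) 1 0 1 1).natDegree ≤ n := by
  rw [natDegree_le_iff_coeff_eq_zero]
  intro k hk
  rw [coeff_fugacityPartition, gammaFreeCount_of_lt n (by exact_mod_cast hk), Nat.cast_zero]

theorem StaircaseTableau.eval_zero_fugacityPartition (n : ℕ) :
    (fugacityPartition n (1 : ℝ) 1 0 1 1).eval 0 = 1 := by
  induction n with
  | zero => simp [fugacityPartition_eq_gammaFreeSum, gammaFreeSum_zero]
  | succ n ih => simp [fugacityPartition_succ, ih]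

theorem StaircaseTableau.fugacityPartition_ne_zero (n : ℕ) :
    fugacityPartition n (1 : ℝ) 1 0 1 1 ≠ 0 := fun h => by
  simpa [h] using eval_zero_fugacityPartition n

theorem StaircaseTableau.exists_roots_fugacityPartition (n : ℕ) :
    ∃ S : Finset ℝ, S.card = n ∧ ∀ s ∈ S, s ∈ Set.Ioo (-1 : ℝ) 0 ∧
      (fugacityPartition n (1 : ℝ) 1 0 1 1).eval s = 0 := by
  induction n with
  | zero => exact ⟨∅, by simp⟩
  | succ n ih =>
    obtain ⟨S, hS, h⟩ := ih
    rw [← hS]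
    rw [← hS] at h
    exact exists_card_succ_roots _ (fugacityPartition_succ _) (fugacityPartition_ne_zero _) S h

/-- The partition function splits into distinct linear factors with roots in `]-1, 0[`. -/
theorem StaircaseTableau.exists_fugacityPartition_eq_prod (n : ℕ) :
    ∃ (c : ℝ) (S : Finset ℝ), 0 < c ∧ (∀ s ∈ S, s ∈ Set.Ioo (-1 : ℝ) 0) ∧
      fugacityPartition n (1 : ℝ) 1 0 1 1 = C c * ∏ s ∈ S, (X - C s) := by
  obtain ⟨S, hcard, hS⟩ := exists_roots_fugacityPartition n
  have heq := Polynomial.eq_C_mul_prod_of_card_roots (fugacityPartition_ne_zero n) S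
    (fun s hs => (hS s hs).2) ((natDegree_fugacityPartition_le n).trans hcard.ge)
  refine ⟨_, S, ?_, fun s hs => (hS s hs).1, heq⟩
  -- The value 1 at y = 0 equals c ∏ (-s) with every -s > 0, which forces c > 0.
  have h0 := eval_zero_fugacityPartition n
  rw [heq] at h0
  simp only [eval_mul, eval_C, eval_prod, eval_sub, eval_X, zero_sub] at h0
  have hpos : 0 < ∏ s ∈ S, -s := Finset.prod_pos fun s hs => neg_pos.2 (hS s hs).1.2
  exact pos_of_mul_pos_left (by rw [h0]; exact one_pos) hpos.le

theorem proposition4 :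
    (∀ n : ℕ, 1 ≤ n → ∀ k : ℤ,
      (StaircaseTableau.gammaFreeCount n k : ℤ) =
        (k + 1) * (StaircaseTableau.gammaFreeCount (n - 1) k : ℤ)
          + ((n : ℤ) + 1) * (StaircaseTableau.gammaFreeCount (n - 1) (k - 1) : ℤ)
          + ((n : ℤ) - k + 1) * (StaircaseTableau.gammaFreeCount (n - 1) (k - 2) : ℤ)) ∧
    (∀ n : ℕ,
      (∀ z : ℂ, Polynomial.aeval z
          (StaircaseTableau.fugacityPartition n (1 : ℝ) 1 0 1 1) = 0 →
        ∃ x : ℝ, x ∈ Set.Ioo (-1 : ℝ) 0 ∧ z = (x : ℂ)) ∧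
      IsStablePoly (StaircaseTableau.fugacityPartition n (1 : ℝ) 1 0 1 1) ∧
      IsHurwitzStablePoly (StaircaseTableau.fugacityPartition n (1 : ℝ) 1 0 1 1) ∧
      IsLogConcavePoly (StaircaseTableau.fugacityPartition n (1 : ℝ) 1 0 1 1)) := by

  refine ⟨fun n hn k => ?_, fun n => ?_⟩
  · obtain ⟨n, rfl⟩ : ∃ m, n = m + 1 := ⟨n - 1, by omega⟩
    rw [StaircaseTableau.gammaFreeCount_succ, Nat.add_sub_cancel]
    push_cast
    ring
  · obtain ⟨c, S, hc, hS, heq⟩ := StaircaseTableau.exists_fugacityPartition_eq_prod n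
    have hroots : ∀ z : ℂ, Polynomial.aeval z
        (StaircaseTableau.fugacityPartition n (1 : ℝ) 1 0 1 1) = 0 →
        ∃ x : ℝ, x ∈ Set.Ioo (-1 : ℝ) 0 ∧ z = (x : ℂ) := by
      intro z hz
      rw [heq, map_mul, map_prod, mul_eq_zero, Finset.prod_eq_zero_iff] at hz
      rcases hz with hz | ⟨s, hs, hz⟩
      · simp [hc.ne'] at hz
      · refine ⟨s, hS s hs, ?_⟩
        simpa [sub_eq_zero] using hz
    refine ⟨hroots, fun z hz h => ?_, fun z hz h => ?_, ?_⟩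
    · obtain ⟨x, -, rfl⟩ := hroots z h
      simp at hz
    · obtain ⟨x, hx, rfl⟩ := hroots z h
      rw [Complex.ofReal_re] at hz
      exact hz.not_gt hx.2
    · rw [heq]
      exact (isStronglyLogConcave_C_mul_prod hc.le S fun s hs => (hS s hs).2.le).isLogConcavePoly
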